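/- Let $\mathbb{T}$ be an infinite random recursive tree on the vertices $1,2,3,\dots$: the root is $1$, and each vertex $i\ge 2$ has a parent $u_i$ that is uniformly distributed on $\{1,\dots,i-1\}$, the $u_i$ being independent. Let $(\epsilon_i)_{i\ge 2}$ be i.i.d. standard exponential random variables, independent of $\mathbb{T}$, and remove the edge between $i$ and $u_i$ at time $\epsilon_i$. For $t\ge 0$ let $\Pi_1(t),\Pi_2(t),\dots$ be the clusters (sets of vertices that are connected by edges not removed up to time $t$), listed in the increasing order of their smallest elements, with $\Pi_i(t)=\emptyset$ if there are fewer than $i$ clusters; in particular $\Pi_1(t)$ is the cluster containing the root. For every $t>0$, almost surely, the limit $$X_i(t)=\lim_{n\to\infty} n^{-\mathrm{e}^{-t}}\,\#\{j\le n: j\in\Pi_i(t)\}$$ (the weight of the $i$-th cluster at time $t$) exists in $\mathbb{R}$ for every $i\ge 1$, and $$\lim_{t\to 0+}\mathbb{P}\bigl(X_1(t)>X_i(t)\text{ for all } i\ge 2\bigr)=1.$$ -/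

import Mathlib

open Filter Topology MeasureTheory ProbabilityTheory

namespace RecursiveTree

/-- An infinite random recursive tree on the vertices `1, 2, 3, …` together with the removal times
of its edges. For `i ≥ 2`, `u i` is the parent of the vertex `i` and `ε i` is the time at which the
edge from `i` to its parent is removed. The values of `u` and `ε` at `0` and `1` play no role. -/
structure IsDestruction {Ω : Type*} [MeasurableSpace Ω] (P : Measure Ω)
    (u : ℕ → Ω → ℕ) (ε : ℕ → Ω → ℝ) : Prop where
  measurable_parent : ∀ i, 2 ≤ i → Measurable (u i)
  measurable_time : ∀ i, 2 ≤ i → Measurable (ε i)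
  /-- the parent of `i` is uniform on `{1, …, i - 1}` -/
  law_parent : ∀ i, 2 ≤ i → P.map (u i) = uniformOn (Set.Ico 1 i)
  /-- the parents of the different vertices are independent -/
  indep_parent : iIndepFun (fun k : ℕ => u (k + 2)) P
  /-- the removal times are standard exponential -/
  law_time : ∀ i, 2 ≤ i → P.map (ε i) = expMeasure 1
  /-- the removal times of the different edges are independent -/
  indep_time : iIndepFun (fun k : ℕ => ε (k + 2)) P
  /-- the family of removal times is independent of the tree -/
  indep_parent_time :
    IndepFun (fun ω (k : ℕ) => u (k + 2) ω) (fun ω (k : ℕ) => ε (k + 2) ω) P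

/-- For a parent function `p` and removal times `e`, the graph of the edges that are
still present at time `t`: those joining `i ≥ 2` to `p i` with `e i > t`. -/
def remaining (p : ℕ → ℕ) (e : ℕ → ℝ) (t : ℝ) : SimpleGraph ℕ :=
  SimpleGraph.fromRel (fun i j => 2 ≤ i ∧ p i = j ∧ t < e i)

/-- The set of vertices (positive integers) connected to `j` in `G`. -/
def cluster (G : SimpleGraph ℕ) (j : ℕ) : Set ℕ :=
  {k | 1 ≤ k ∧ G.Reachable j k}

/-- The index of the cluster of `j`, when the clusters are listed `1, 2, …` in the increasing order
of their smallest elements: the number of the `m` which are the smallest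
element of some cluster and are at most the smallest element of the cluster of `j`. -/
noncomputable def clusterIndex (G : SimpleGraph ℕ) (j : ℕ) : ℕ :=
  {m | IsLeast (cluster G m) m ∧ m ∈ lowerBounds (cluster G j)}.ncard

/-- The `i`-th block (`i ≥ 1`) of the partition of `{1, 2, …}` into the clusters of `G`, the blocks
being listed in the increasing order of their smallest elements; it is empty if there are fewer
than `i` clusters. -/
def block (G : SimpleGraph ℕ) (i : ℕ) : Set ℕ :=
  {j | 1 ≤ j ∧ clusterIndex G j = i}

/-- The sequence `n ↦ n ^ (-exp (-t)) * #{j ≤ n : j ∈ B}`. -/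
noncomputable def scaledCount (t : ℝ) (B : Set ℕ) (n : ℕ) : ℝ :=
  (n : ℝ) ^ (-Real.exp (-t)) * ({j | j ≤ n ∧ j ∈ B}.ncard : ℝ)

/-- The weight of a block `B` at time `t`: the limit of its scaled counts. -/
noncomputable def weight (t : ℝ) (B : Set ℕ) : ℝ :=
  limUnder atTop (scaledCount t B)

/-- The `i`-th block `Π_i(t)` of the partition at time `t`, as a function of `ω`. -/
def partBlock {Ω : Type*} (u : ℕ → Ω → ℕ) (ε : ℕ → Ω → ℝ) (i : ℕ) (t : ℝ) (ω : Ω) : Set ℕ :=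
  block (remaining (fun k => u k ω) (fun k => ε k ω) t) i

/-- The weight `X_i(t)` of the `i`-th block at time `t`. -/
noncomputable def X {Ω : Type*} (u : ℕ → Ω → ℕ) (ε : ℕ → Ω → ℝ) (i : ℕ) (t : ℝ) (ω : Ω) : ℝ :=
  weight t (partBlock u ε i t ω)

end RecursiveTree

namespace RecursiveTree

/-! Write a = e^{-t}. Labels increase away from the root of the tree, so a nonempty block is the set
of descendants, along surviving edges, of its smallest element, which is 1 or a vertex whose parent
edge is cut (`block_eq_empty_or`). It thus suffices to study the number N_m(n) of such descendants
of m with label at most n.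

Given the first n vertices, vertex n + 1 joins the descendants of m with probability a N_m(n) / n.
So N_m(n) / ∏_{k<n} (1 + a/k) is a nonnegative martingale (`martingale_size`); the product is
asymptotic to n^a / Γ(1 + a), and all weights exist almost surely. Likewise E[N_m (N_m + 1)] is
multiplied by 1 + 2a/n at each step (`integral_mul_size_sq_succ`), which gives second moments.

Dominance of the root cluster follows by comparing weights with 1/2. For the root, the scaled size Y
satisfies lim sup E(Y - 1)² ≤ 2/Γ(1 + 2a) - 2/Γ(1 + a) + 1, which tends to 0 as a → 1
(`measure_root_weight_le`). For m ≥ 2, being cut off and having weight at least 1/2 has probability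
at most of order (1 - a) m^{-2a} (`measure_detached_weight_le`). For 2a ≥ 3/2 this is summable in m,
and the factor 1 - a sends the sum to 0. -/

/-- `Descends p e t m j`: the vertex `j` is joined to `m` by a path of parents along edges that are
still present at time `t`. -/
inductive Descends (p : ℕ → ℕ) (e : ℕ → ℝ) (t : ℝ) (m : ℕ) : ℕ → Prop
  | refl : Descends p e t m m
  | step {j : ℕ} (hmj : m < j) (hj : t < e j) (hp : p j < j) (h : Descends p e t m (p j)) :
      Descends p e t m j

/-- `m` is the vertex `1`, or the edge from `m` to its parent is removed by time `t`. -/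
def IsRoot (e : ℕ → ℝ) (t : ℝ) (m : ℕ) : Prop := 1 ≤ m ∧ (m = 1 ∨ e m ≤ t)

/-! ### Clusters as descendant sets of roots -/

section Deterministic

variable {p : ℕ → ℕ} {e : ℕ → ℝ} {t : ℝ} {m m' i j k : ℕ}

theorem descends_iff :
    Descends p e t m j ↔ j = m ∨ m < j ∧ t < e j ∧ p j < j ∧ Descends p e t m (p j) := by
  constructor
  · rintro (_ | ⟨h1, h2, h3, h4⟩)
    · exact Or.inl rfl
    · exact Or.inr ⟨h1, h2, h3, h4⟩
  · rintro (rfl | ⟨h1, h2, h3, h4⟩)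
    · exact .refl
    · exact .step h1 h2 h3 h4

theorem Descends.le (h : Descends p e t m j) : m ≤ j := by
  cases h with
  | refl => exact le_rfl
  | step h => exact h.le

theorem exists_root_descends (hp : ∀ i, 2 ≤ i → 1 ≤ p i ∧ p i < i) (hj : 1 ≤ j) :
    ∃ m, IsRoot e t m ∧ Descends p e t m j := by
  induction j using Nat.strong_induction_on with
  | _ j ih =>
    by_cases hr : IsRoot e t j
    · exact ⟨j, hr, .refl⟩
    · have h2 : 2 ≤ j := by
        by_contra h
        exact hr ⟨hj, Or.inl (by omega)⟩
      have he : t < e j := by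
        by_contra h
        exact hr ⟨hj, Or.inr (not_lt.1 h)⟩
      obtain ⟨m, hm, hd⟩ := ih (p j) (hp j h2).2 (hp j h2).1
      exact ⟨m, hm, .step (lt_of_le_of_lt hd.le (hp j h2).2) he (hp j h2).2 hd⟩

theorem Descends.reachable (hm : 1 ≤ m) (h : Descends p e t m j) :
    (remaining p e t).Reachable m j := by
  induction h with
  | refl => exact SimpleGraph.Reachable.refl _
  | step h1 h2 h3 _ ih =>
    refine ih.trans (SimpleGraph.Adj.reachable ?_)
    rw [remaining, SimpleGraph.fromRel_adj]
    exact ⟨h3.ne, Or.inr ⟨by omega, rfl, h2⟩⟩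

/-- A root other than 1 has its parent edge cut, so a vertex `i` whose edge survives is not `m`
itself; its membership is therefore decided by its parent. -/
theorem descends_parent_iff (hp : ∀ i, 2 ≤ i → 1 ≤ p i ∧ p i < i) (hm : IsRoot e t m)
    (hi : 2 ≤ i) (he : t < e i) : Descends p e t m i ↔ Descends p e t m (p i) := by
  rw [descends_iff]
  constructor
  · rintro (rfl | h)
    · rcases hm.2 with h | h
      · omega
      · exact absurd he (not_lt.2 h)
    · exact h.2.2.2
  · intro h
    exact Or.inr ⟨lt_of_le_of_lt h.le (hp i hi).2, he, (hp i hi).2, h⟩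

/-- Every edge of the remaining graph joins a vertex to its parent, so membership is preserved along
each edge of a walk. -/
theorem descends_iff_of_reachable (hp : ∀ i, 2 ≤ i → 1 ≤ p i ∧ p i < i) (hm : IsRoot e t m)
    (h : (remaining p e t).Reachable i j) : Descends p e t m i ↔ Descends p e t m j := by
  obtain ⟨w⟩ := h
  induction w with
  | nil => rfl
  | cons hadj _ ih =>
    refine Iff.trans ?_ ih
    rw [remaining, SimpleGraph.fromRel_adj] at hadj
    obtain ⟨-, ⟨h1, rfl, h2⟩ | ⟨h1, rfl, h2⟩⟩ := hadj
    · exact descends_parent_iff hp hm h1 h2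
    · exact (descends_parent_iff hp hm h1 h2).symm

theorem cluster_eq (hp : ∀ i, 2 ≤ i → 1 ≤ p i ∧ p i < i) (hm : IsRoot e t m)
    (h : Descends p e t m j) : cluster (remaining p e t) j = {k | Descends p e t m k} := by
  ext k
  constructor
  · rintro ⟨-, hk⟩
    exact (descends_iff_of_reachable hp hm hk).1 h
  · intro hk
    exact ⟨hm.1.trans hk.le, (h.reachable hm.1).symm.trans (hk.reachable hm.1)⟩

theorem isLeast_cluster_iff (hp : ∀ i, 2 ≤ i → 1 ≤ p i ∧ p i < i) :
    IsLeast (cluster (remaining p e t) m) m ↔ IsRoot e t m := by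
  constructor
  · rintro ⟨⟨h1, -⟩, h2⟩
    obtain ⟨m', hm', hd⟩ := exists_root_descends (e := e) (t := t) hp h1
    rw [cluster_eq hp hm' hd] at h2
    have := h2 (show m' ∈ {k | Descends p e t m' k} from .refl)
    rwa [le_antisymm this hd.le]
  · intro hm
    rw [cluster_eq hp hm .refl]
    exact ⟨.refl, fun k hk => Descends.le hk⟩

theorem clusterIndex_eq (hp : ∀ i, 2 ≤ i → 1 ≤ p i ∧ p i < i) (hm : IsRoot e t m)
    (h : Descends p e t m j) :
    clusterIndex (remaining p e t) j = {x | IsRoot e t x ∧ x ≤ m}.ncard := by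
  unfold clusterIndex
  congr 1
  ext x
  simp only [Set.mem_ofPred_eq, isLeast_cluster_iff hp, cluster_eq hp hm h]
  refine and_congr_right fun _ => ⟨fun hx => hx (show Descends p e t m m from .refl), ?_⟩
  intro hx k hk
  exact hx.trans (Descends.le hk)

/-- By this strict monotonicity the index of a cluster determines its root. -/
theorem ncard_roots_strictMono (hm' : IsRoot e t m') (h : m < m') :
    {x | IsRoot e t x ∧ x ≤ m}.ncard < {x | IsRoot e t x ∧ x ≤ m'}.ncard := by
  refine Set.ncard_lt_ncard ⟨fun x hx => ⟨hx.1, hx.2.trans h.le⟩, fun hs => ?_⟩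
    ((Set.finite_Iic m').subset fun x hx => hx.2)
  exact absurd (hs ⟨hm', le_rfl⟩ : IsRoot e t m' ∧ m' ≤ m).2 (not_le.2 h)

/-- A block of the partition that has an element is the set of descendants of a root. -/
theorem block_eq_of_mem (hp : ∀ i, 2 ≤ i → 1 ≤ p i ∧ p i < i) (hm : IsRoot e t m)
    (h : Descends p e t m j) (hj : j ∈ block (remaining p e t) i) :
    block (remaining p e t) i = {k | Descends p e t m k} := by
  have hi := hj.2
  rw [clusterIndex_eq hp hm h] at hi
  ext k
  constructor
  · rintro ⟨h1, h2⟩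
    obtain ⟨m', hm', hd⟩ := exists_root_descends (e := e) (t := t) hp h1
    rw [clusterIndex_eq hp hm' hd, ← hi] at h2
    rcases lt_trichotomy m m' with hlt | rfl | hlt
    · exact absurd h2 (ncard_roots_strictMono hm' hlt).ne'
    · exact hd
    · exact absurd h2 (ncard_roots_strictMono hm hlt).ne
  · intro hk
    exact ⟨hm.1.trans (Descends.le hk), by rw [clusterIndex_eq hp hm hk, hi]⟩

theorem clusterIndex_one (hp : ∀ i, 2 ≤ i → 1 ≤ p i ∧ p i < i) :
    clusterIndex (remaining p e t) 1 = 1 := by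
  have h1 : IsRoot e t 1 := ⟨le_rfl, Or.inl rfl⟩
  rw [clusterIndex_eq hp h1 .refl, Set.ncard_eq_one]
  exact ⟨1, Set.ext fun x => ⟨fun hx => le_antisymm hx.2 hx.1.1, by rintro rfl; exact ⟨h1, le_rfl⟩⟩⟩

theorem block_one (hp : ∀ i, 2 ≤ i → 1 ≤ p i ∧ p i < i) :
    block (remaining p e t) 1 = {k | Descends p e t 1 k} :=
  block_eq_of_mem hp ⟨le_rfl, Or.inl rfl⟩ .refl ⟨le_rfl, clusterIndex_one hp⟩

/-- A block is empty or the set of descendants of a root, which is not `1` for `i ≥ 2`. -/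
theorem block_eq_empty_or (hp : ∀ i, 2 ≤ i → 1 ≤ p i ∧ p i < i) (i : ℕ) :
    block (remaining p e t) i = ∅ ∨ ∃ m, IsRoot e t m ∧ (2 ≤ i → 2 ≤ m) ∧
      block (remaining p e t) i = {k | Descends p e t m k} := by
  rcases Set.eq_empty_or_nonempty (block (remaining p e t) i) with h | ⟨j, hj⟩
  · exact Or.inl h
  · obtain ⟨m, hm, hd⟩ := exists_root_descends (e := e) (t := t) hp hj.1
    have hb := block_eq_of_mem hp hm hd hj
    refine Or.inr ⟨m, hm, fun hi => ?_, hb⟩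
    have hmem : m ∈ block (remaining p e t) i := by rw [hb]; exact .refl
    have := hm.1
    by_contra hlt
    obtain rfl : m = 1 := by omega
    have := hmem.2
    rw [clusterIndex_one hp] at this
    omega

theorem scaledCount_empty (t : ℝ) : scaledCount t ∅ = fun _ => 0 := by
  funext n
  simp [scaledCount]

end Deterministic

/-! ### Asymptotics of the normalising product -/

/-- The product `∏ (1 + x / k)` over `1 ≤ k < n`. -/
noncomputable def growth (x : ℝ) (n : ℕ) : ℝ := ∏ k ∈ Finset.Ico 1 n, (1 + x / k)

theorem growth_one (x : ℝ) : growth x 1 = 1 := by simp [growth]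

theorem growth_succ (x : ℝ) {n : ℕ} (hn : 1 ≤ n) :
    growth x (n + 1) = growth x n * (1 + x / n) :=
  Finset.prod_Ico_succ_top hn _

theorem growth_pos {x : ℝ} (hx : 0 ≤ x) (n : ℕ) : 0 < growth x n :=
  Finset.prod_pos fun _ _ => by positivity

theorem growth_le_growth {x y : ℝ} (hx : 0 ≤ x) (hxy : x ≤ y) (n : ℕ) :
    growth x n ≤ growth y n :=
  Finset.prod_le_prod (fun _ _ => by positivity) fun _ _ => by gcongr

/-- Euler's limit formula for Γ has x(x + 1)⋯(x + n) in the denominator; factoring out x and n!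
leaves the product. -/
theorem gammaSeq_eq_rpow_div_growth {x : ℝ} (hx : 0 < x) (n : ℕ) :
    Real.GammaSeq x n = (n : ℝ) ^ x / (x * growth x (n + 1)) := by
  have h : ∏ j ∈ Finset.range (n + 1), (x + j) = n.factorial * (x * growth x (n + 1)) := by
    induction n with
    | zero => simp [growth]
    | succ n ih =>
      rw [Finset.prod_range_succ, ih, growth_succ x (Nat.le_add_left 1 n), Nat.factorial_succ]
      push_cast
      field_simp
      ring
  rw [Real.GammaSeq, h, mul_comm (_ ^ _), mul_div_mul_left]
  positivity

theorem tendsto_growth_div_rpow {x : ℝ} (hx : 0 < x) :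
    Tendsto (fun n : ℕ => growth x n / (n : ℝ) ^ x) atTop (𝓝 (1 / Real.Gamma (1 + x))) := by
  have h1 := (Real.GammaSeq_tendsto_Gamma x).inv₀ (Real.Gamma_pos_of_pos hx).ne'
  have h2 : Tendsto (fun n : ℕ => x * (1 + x / n)) atTop (𝓝 (x * (1 + 0))) :=
    ((tendsto_const_div_atTop_nhds_zero_nat x).const_add 1).const_mul x
  have h3 := h1.div h2 (by simpa using hx.ne')
  have h4 : (Real.Gamma x)⁻¹ / (x * (1 + 0)) = 1 / Real.Gamma (1 + x) := by
    rw [add_comm 1 x, Real.Gamma_add_one hx.ne']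
    field_simp
    simp
  rw [h4] at h3
  refine h3.congr' ?_
  filter_upwards [eventually_ge_atTop 1] with n hn
  have hn' : (0 : ℝ) < n := by exact_mod_cast hn
  have hg := growth_pos hx.le n
  have hr : (0 : ℝ) < (n : ℝ) ^ x := by positivity
  simp only [Pi.div_apply]
  rw [gammaSeq_eq_rpow_div_growth hx, growth_succ x hn]
  field_simp

/-- The product grows like n^x. This makes the union bound over all cut vertices converge. -/
theorem summable_inv_growth {x : ℝ} (hx : 1 < x) : Summable fun n => (growth x n)⁻¹ := by
  have hx0 : 0 < x := by linarith
  have h1 := (tendsto_growth_div_rpow hx0).inv₀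
    (one_div_pos.2 (Real.Gamma_pos_of_pos (by linarith))).ne'
  have h2 : (fun n => (growth x n)⁻¹) =O[atTop] fun n : ℕ => ((n : ℝ) ^ x)⁻¹ := by
    have h3 := (h1.isBigO_one ℝ).mul (Asymptotics.isBigO_refl (fun n : ℕ => ((n : ℝ) ^ x)⁻¹) atTop)
    refine (h3.congr' ?_ (by simp))
    filter_upwards [eventually_ge_atTop 1] with n hn
    have hn' : (0 : ℝ) < n := by exact_mod_cast hn
    have hr : (0 : ℝ) < (n : ℝ) ^ x := by positivity
    field_simp
  exact summable_of_isBigO_nat (Real.summable_nat_rpow_inv.2 hx) h2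

/-! ### Histories and descendant counts -/

section Probability

variable {Ω : Type*} {u : ℕ → Ω → ℕ} {ε : ℕ → Ω → ℝ}

/-- The σ-algebra generated by the parent and the removal time of the vertex `k + 2`. -/
@[reducible] def edgeAlgebra (u : ℕ → Ω → ℕ) (ε : ℕ → Ω → ℝ) (k : ℕ) : MeasurableSpace Ω :=
  MeasurableSpace.comap (fun ω => (u (k + 2) ω, ε (k + 2) ω)) inferInstance

/-- The σ-algebra generated by the parents and the removal times of the vertices up to `n`. -/
@[reducible] def history (u : ℕ → Ω → ℕ) (ε : ℕ → Ω → ℝ) (n : ℕ) : MeasurableSpace Ω :=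
  ⨆ k ∈ {k : ℕ | k + 2 ≤ n}, edgeAlgebra u ε k

theorem history_mono : Monotone (history u ε) := fun _ _ h =>
  biSup_mono fun _ hk => le_trans hk h

theorem edgeAlgebra_le_history {k n : ℕ} (h : k + 2 ≤ n) : edgeAlgebra u ε k ≤ history u ε n :=
  le_biSup (edgeAlgebra u ε) h

theorem measurable_parent_edgeAlgebra (k : ℕ) : Measurable[edgeAlgebra u ε k] (u (k + 2)) :=
  measurable_fst.comp (comap_measurable fun ω => (u (k + 2) ω, ε (k + 2) ω))

theorem measurable_time_edgeAlgebra (k : ℕ) : Measurable[edgeAlgebra u ε k] (ε (k + 2)) :=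
  measurable_snd.comp (comap_measurable fun ω => (u (k + 2) ω, ε (k + 2) ω))

/-- The event that `j` is joined to `m` by a path of parents at time `t`. -/
def descendsEvent (u : ℕ → Ω → ℕ) (ε : ℕ → Ω → ℝ) (t : ℝ) (m j : ℕ) : Set Ω :=
  {ω | Descends (fun k => u k ω) (fun k => ε k ω) t m j}

/-- The event that the parent of `j` is `i` and that the edge is present at time `t`. -/
def edgeEvent (u : ℕ → Ω → ℕ) (ε : ℕ → Ω → ℝ) (t : ℝ) (i j : ℕ) : Set Ω :=
  {ω | u j ω = i ∧ t < ε j ω}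

/-- The number of the vertices up to `n` that are joined to `m` by a path of parents at time `t`. -/
noncomputable def size (u : ℕ → Ω → ℕ) (ε : ℕ → Ω → ℝ) (t : ℝ) (m n : ℕ) (ω : Ω) : ℝ :=
  ∑ j ∈ Finset.Icc m n, (descendsEvent u ε t m j).indicator (fun _ => (1 : ℝ)) ω

variable {t : ℝ} {m n i : ℕ}

theorem size_self : size u ε t m m = fun _ => 1 := by
  funext ω
  simp [size, descendsEvent, Descends.refl]

theorem size_succ (h : m ≤ n) (ω : Ω) : size u ε t m (n + 1) ω =
    size u ε t m n ω + (descendsEvent u ε t m (n + 1)).indicator (fun _ => (1 : ℝ)) ω :=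
  Finset.sum_Icc_succ_top (by omega) _

theorem size_nonneg (ω : Ω) : 0 ≤ size u ε t m n ω :=
  Finset.sum_nonneg fun _ _ => Set.indicator_nonneg (fun _ _ => zero_le_one) _

theorem size_le (ω : Ω) : size u ε t m n ω ≤ (Finset.Icc m n).card := by
  classical
  rw [size, Finset.card_eq_sum_ones, Nat.cast_sum]
  refine Finset.sum_le_sum fun j _ => ?_
  rw [Set.indicator_apply]
  split_ifs <;> simp

theorem scaledCount_descends (ω : Ω) (n : ℕ) :
    scaledCount t {j | Descends (fun k => u k ω) (fun k => ε k ω) t m j} n =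
      (n : ℝ) ^ (-Real.exp (-t)) * size u ε t m n ω := by
  classical
  have h : {j | j ≤ n ∧ j ∈ {j | Descends (fun k => u k ω) (fun k => ε k ω) t m j}} =
      ((Finset.Icc m n).filter fun j => ω ∈ descendsEvent u ε t m j : Finset ℕ) := by
    ext j
    rw [Finset.mem_coe, Finset.mem_filter, Finset.mem_Icc]
    exact ⟨fun h => ⟨⟨h.2.le, h.1⟩, h.2⟩, fun h => ⟨h.1.2, h.2⟩⟩
  rw [scaledCount, h, Set.ncard_coe_finset, size]
  congr 1
  rw [Finset.card_filter, Nat.cast_sum]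
  refine Finset.sum_congr rfl fun j _ => ?_
  by_cases hj : ω ∈ descendsEvent u ε t m j <;> simp [hj]

/-- Splitting over the parent `i` of the new vertex separates a factor known from the first `n`
vertices from one that depends only on the new edge. -/
theorem indicator_descendsEvent_succ (h : m ≤ n) (ω : Ω) :
    (descendsEvent u ε t m (n + 1)).indicator (fun _ => (1 : ℝ)) ω =
      ∑ i ∈ Finset.Icc m n, (descendsEvent u ε t m i).indicator (fun _ => (1 : ℝ)) ω *
        (edgeEvent u ε t i (n + 1)).indicator (fun _ => (1 : ℝ)) ω := by
  have hiff := descends_iff (p := fun k => u k ω) (e := fun k => ε k ω) (t := t) (m := m)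
    (j := n + 1)
  by_cases hd : ω ∈ descendsEvent u ε t m (n + 1)
  · rcases hiff.1 hd with h' | ⟨-, h1, h2, h3⟩
    · omega
    · rw [Finset.sum_eq_single_of_mem (u (n + 1) ω)
        (Finset.mem_Icc.2 ⟨h3.le, Nat.lt_succ_iff.1 h2⟩)]
      · have h3' : ω ∈ descendsEvent u ε t m (u (n + 1) ω) := h3
        have h4 : ω ∈ edgeEvent u ε t (u (n + 1) ω) (n + 1) := ⟨rfl, h1⟩
        simp [hd, h3', h4]
      · intro i _ hi
        have h4 : ω ∉ edgeEvent u ε t i (n + 1) := fun hh => hi hh.1.symm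
        simp [h4]
  · rw [Set.indicator_of_notMem hd, eq_comm]
    refine Finset.sum_eq_zero fun i hi => ?_
    by_cases h1 : ω ∈ descendsEvent u ε t m i
    · have h4 : ω ∉ edgeEvent u ε t i (n + 1) := by
        rintro ⟨rfl, h5⟩
        rw [Finset.mem_Icc] at hi
        exact hd (hiff.2 (Or.inr ⟨by omega, h5, by omega, h1⟩))
      simp [h4]
    · simp [h1]

theorem measurableSet_edgeEvent (t : ℝ) (i k : ℕ) :
    MeasurableSet[edgeAlgebra u ε k] (edgeEvent u ε t i (k + 2)) := by
  have h1 := measurable_parent_edgeAlgebra (u := u) (ε := ε) k (measurableSet_singleton i)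
  have h2 := measurable_time_edgeAlgebra (u := u) (ε := ε) k (measurableSet_Ioi (a := t))
  exact MeasurableSet.inter h1 h2

theorem measurableSet_descendsEvent (hm : 1 ≤ m) (t : ℝ) (j : ℕ) :
    MeasurableSet[history u ε j] (descendsEvent u ε t m j) := by
  induction j using Nat.strong_induction_on with
  | _ j ih =>
    rcases lt_trichotomy j m with hj | rfl | hj
    · convert MeasurableSet.empty
      exact Set.eq_empty_of_forall_notMem fun ω hω => absurd (Descends.le hω) (not_le.2 hj)
    · convert MeasurableSet.univ
      exact Set.eq_univ_of_forall fun ω => .refl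
    · obtain ⟨k, rfl⟩ : ∃ k, j = k + 2 := ⟨j - 2, by omega⟩
      have h : descendsEvent u ε t m (k + 2) = ⋃ i ∈ Finset.range (k + 2),
          edgeEvent u ε t i (k + 2) ∩ descendsEvent u ε t m i := by
        ext ω
        simp only [Set.mem_iUnion, Finset.mem_range, exists_prop, Set.mem_inter_iff]
        refine Iff.trans descends_iff ?_
        constructor
        · rintro (h' | ⟨-, h1, h2, h3⟩)
          · omega
          · exact ⟨_, h2, ⟨rfl, h1⟩, h3⟩
        · rintro ⟨i, hi, ⟨rfl, h1⟩, h3⟩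
          exact Or.inr ⟨hj, h1, hi, h3⟩
      rw [h]
      refine Finset.measurableSet_biUnion _ fun i hi => MeasurableSet.inter ?_ ?_
      · exact edgeAlgebra_le_history le_rfl _ (measurableSet_edgeEvent t i k)
      · exact history_mono (Finset.mem_range.1 hi).le _ (ih i (Finset.mem_range.1 hi))

theorem measurable_size (hm : 1 ≤ m) (t : ℝ) (n : ℕ) :
    Measurable[history u ε n] (size u ε t m n) := by
  unfold size
  refine Finset.measurable_sum _ fun j hj => ?_
  exact Measurable.indicator measurable_const
    (history_mono (Finset.mem_Icc.1 hj).2 _ (measurableSet_descendsEvent hm t j))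

theorem integrable_mul_indicator [MeasurableSpace Ω] {P : Measure Ω}
    {f : Ω → ℝ} (hf : Integrable f P) {s : Set Ω}
    (hs : MeasurableSet s) : Integrable (fun ω => f ω * s.indicator (fun _ => (1 : ℝ)) ω) P := by
  refine (hf.indicator hs).congr (ae_of_all _ fun ω => ?_)
  by_cases hω : ω ∈ s <;> simp [hω]

/-! ### Independence of the edges and moment recursions -/

namespace IsDestruction

variable [MeasurableSpace Ω] {P : Measure Ω} (h : IsDestruction P u ε)
include h

theorem edgeAlgebra_le (k : ℕ) : edgeAlgebra u ε k ≤ ‹MeasurableSpace Ω› :=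
  ((h.measurable_parent _ (by omega)).prodMk (h.measurable_time _ (by omega))).comap_le

theorem history_le (n : ℕ) : history u ε n ≤ ‹MeasurableSpace Ω› :=
  iSup₂_le fun k _ => h.edgeAlgebra_le k

/-- On rectangles, the independence of tree and times splits the probability into a parent part and
a time part, and each part factors over the vertices. Rectangles form a generating π-system. -/
theorem iIndep_edgeAlgebra : iIndep (edgeAlgebra u ε) P := by
  refine iIndepSets.iIndep h.edgeAlgebra_le
    (fun k => {s | ∃ r ∈ Set.image2 (· ×ˢ ·) {s : Set ℕ | MeasurableSet s}
      {s : Set ℝ | MeasurableSet s}, (fun ω => (u (k + 2) ω, ε (k + 2) ω)) ⁻¹' r = s})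
    (fun k => isPiSystem_prod.comap _) (fun k => ?_) ?_
  · rw [edgeAlgebra, ← generateFrom_prod, MeasurableSpace.comap_generateFrom]
    rfl
  · rw [iIndepSets_iff]
    intro s f hf
    have hf' : ∀ k ∈ s, ∃ A : Set ℕ, ∃ B : Set ℝ, MeasurableSet A ∧ MeasurableSet B ∧
        f k = u (k + 2) ⁻¹' A ∩ ε (k + 2) ⁻¹' B := by
      intro k hk
      obtain ⟨_, ⟨A, hA, B, hB, rfl⟩, hr⟩ := hf k hk
      exact ⟨A, B, hA, hB, hr.symm⟩
    choose! A B hA hB hAB using hf'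
    -- Stated for all subsets so that singletons identify the factors `P (f k)`.
    have hprod : ∀ (s' : Finset ℕ) (_ : s' ⊆ s), P (⋂ k ∈ s', f k) =
        (∏ k ∈ s', P (u (k + 2) ⁻¹' A k)) * ∏ k ∈ s', P (ε (k + 2) ⁻¹' B k) := by
      intro s' hs'
      rw [← h.indep_parent.measure_inter_preimage_eq_mul s' fun k hk => hA k (hs' hk),
        ← h.indep_time.measure_inter_preimage_eq_mul s' fun k hk => hB k (hs' hk)]
      have := h.indep_parent_time.measure_inter_preimage_eq_mul
        (⋂ k ∈ s', (fun x : ℕ → ℕ => x k) ⁻¹' A k) (⋂ k ∈ s', (fun x : ℕ → ℝ => x k) ⁻¹' B k)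
        (Finset.measurableSet_biInter _ fun k hk => measurable_pi_apply k (hA k (hs' hk)))
        (Finset.measurableSet_biInter _ fun k hk => measurable_pi_apply k (hB k (hs' hk)))
      simp only [Set.preimage_iInter, ← Set.preimage_comp, Function.comp_def] at this
      convert this using 2
      ext ω
      simp only [Set.mem_iInter, Set.mem_inter_iff, Set.mem_preimage]
      constructor
      · intro hω
        refine ⟨fun k hk => ?_, fun k hk => ?_⟩ <;>
        · have := hω k hk
          rw [hAB k (hs' hk)] at this
          first | exact this.1 | exact this.2
      · intro hω k hk
        rw [hAB k (hs' hk)]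
        exact ⟨hω.1 k hk, hω.2 k hk⟩
    rw [hprod s subset_rfl, ← Finset.prod_mul_distrib]
    refine Finset.prod_congr rfl fun k hk => ?_
    have := hprod {k} (by simpa using hk)
    simpa using this.symm

theorem indep_history (k : ℕ) : Indep (history u ε (k + 1)) (edgeAlgebra u ε k) P := by
  have := indep_iSup_of_disjoint h.edgeAlgebra_le h.iIndep_edgeAlgebra
    (S := {l | l + 2 ≤ k + 1}) (T := {k}) (by simp)
  simpa [history] using this

theorem measureReal_parent_eq (hn : 1 ≤ n) (hi : i ∈ Finset.Icc 1 n) :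
    P.real {ω | u (n + 1) ω = i} = 1 / n := by
  have h1 : P {ω | u (n + 1) ω = i} = uniformOn (Set.Ico 1 (n + 1)) {i} := by
    rw [← h.law_parent (n + 1) (by omega), Measure.map_apply (h.measurable_parent _ (by omega))
      (measurableSet_singleton i)]
    rfl
  have h2 : Set.Ico 1 (n + 1) = (Finset.Icc 1 n : Set ℕ) := by
    ext; simp
  rw [measureReal_def, h1, h2, ← Finset.coe_singleton, uniformOn_apply_finset,
    Finset.inter_singleton_of_mem hi]
  simp

theorem ae_parent : ∀ᵐ ω ∂P, ∀ i, 2 ≤ i → 1 ≤ u i ω ∧ u i ω < i := by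
  rw [ae_all_iff]
  intro i
  by_cases hi : 2 ≤ i
  · have h1 : ∀ᵐ x ∂(P.map (u i)), x ∈ Set.Ico 1 i := by
      rw [h.law_parent i hi]
      exact ae_cond_mem (Set.finite_Ico 1 i).measurableSet
    filter_upwards [ae_of_ae_map (h.measurable_parent i hi).aemeasurable h1] with ω hω _ using hω
  · exact ae_of_all _ fun ω h' => absurd h' hi

theorem measureReal_time_le (ht : 0 ≤ t) (hn : 2 ≤ n) :
    P.real {ω | ε n ω ≤ t} = 1 - Real.exp (-t) := by
  have h1 : P {ω | ε n ω ≤ t} = expMeasure 1 (Set.Iic t) := by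
    rw [← h.law_time n hn, Measure.map_apply (h.measurable_time _ hn) measurableSet_Iic]
    rfl
  have := isProbabilityMeasure_expMeasure (r := 1) one_pos
  have h2 := cdf_expMeasure_eq one_pos t
  rw [cdf_eq_real, if_pos ht, one_mul] at h2
  rw [measureReal_def, h1, ← measureReal_def, h2]

theorem integrable_mul_size {f : Ω → ℝ} (hf : Integrable f P) (hm : 1 ≤ m) (t : ℝ) (n : ℕ) :
    Integrable (fun ω => f ω * size u ε t m n ω) P := by
  refine hf.mul_bdd (c := (Finset.Icc m n).card)
    ((measurable_size hm t n).mono (h.history_le n) le_rfl).aestronglyMeasurable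
    (ae_of_all _ fun ω => ?_)
  rw [Real.norm_eq_abs, abs_of_nonneg (size_nonneg ω)]
  exact size_le ω

variable [IsProbabilityMeasure P]

theorem measureReal_lt_time (ht : 0 ≤ t) (hn : 2 ≤ n) :
    P.real {ω | t < ε n ω} = Real.exp (-t) := by
  have h1 : {ω | t < ε n ω} = {ω | ε n ω ≤ t}ᶜ := by ext; simp
  have h2 : MeasurableSet {ω | ε n ω ≤ t} := h.measurable_time n hn measurableSet_Iic
  rw [h1, measureReal_compl h2, h.measureReal_time_le ht hn]
  simp

theorem measureReal_edgeEvent (ht : 0 ≤ t) (hn : 1 ≤ n) (hi : i ∈ Finset.Icc 1 n) :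
    P.real (edgeEvent u ε t i (n + 1)) = Real.exp (-t) / n := by
  obtain ⟨k, rfl⟩ : ∃ k, n = k + 1 := ⟨n - 1, by omega⟩
  have := h.indep_parent_time.measure_inter_preimage_eq_mul
    ((fun x : ℕ → ℕ => x k) ⁻¹' {i}) ((fun x : ℕ → ℝ => x k) ⁻¹' Set.Ioi t)
    (measurable_pi_apply k (measurableSet_singleton i))
    (measurable_pi_apply k measurableSet_Ioi)
  have h2 : P (edgeEvent u ε t i (k + 2)) =
      P {ω | u (k + 2) ω = i} * P {ω | t < ε (k + 2) ω} := this
  rw [measureReal_def, h2, ENNReal.toReal_mul]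
  have h3 := h.measureReal_parent_eq hn hi
  have h4 := h.measureReal_lt_time (n := k + 2) ht (by omega)
  rw [measureReal_def] at h3 h4
  rw [h3, h4]
  ring

theorem integral_mul_edgeEvent (ht : 0 ≤ t) (hn : 1 ≤ n) (hi : i ∈ Finset.Icc 1 n) {f : Ω → ℝ}
    (hf : Measurable[history u ε n] f) :
    ∫ ω, f ω * (edgeEvent u ε t i (n + 1)).indicator (fun _ => (1 : ℝ)) ω ∂P =
      Real.exp (-t) / n * ∫ ω, f ω ∂P := by
  obtain ⟨k, rfl⟩ : ∃ k, n = k + 1 := ⟨n - 1, by omega⟩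
  have hE := measurableSet_edgeEvent (u := u) (ε := ε) t i k
  have hg : Measurable[edgeAlgebra u ε k]
      ((edgeEvent u ε t i (k + 2)).indicator (fun _ => (1 : ℝ))) :=
    Measurable.indicator measurable_const hE
  have hind : IndepFun f ((edgeEvent u ε t i (k + 2)).indicator (fun _ => (1 : ℝ))) P := by
    rw [IndepFun_iff_Indep]
    exact indep_of_indep_of_le_left (indep_of_indep_of_le_right (h.indep_history k) hg.comap_le)
      hf.comap_le
  rw [hind.integral_fun_mul_eq_mul_integral
    (hf.mono (h.history_le _) le_rfl).aestronglyMeasurable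
    (hg.mono (h.edgeAlgebra_le _) le_rfl).aestronglyMeasurable]
  have : ∫ ω, (edgeEvent u ε t i (k + 2)).indicator (fun _ => (1 : ℝ)) ω ∂P =
      Real.exp (-t) / (k + 1 : ℕ) := by
    rw [← h.measureReal_edgeEvent ht hn hi]
    exact integral_indicator_one (h.edgeAlgebra_le k _ hE)
  rw [this, mul_comm]

/-- Conditionally on the first `n` vertices, the vertex `n + 1` descends from `m` with probability
`exp (-t) / n` times the number of descendants of `m`. -/
theorem integral_mul_descendsEvent_succ (ht : 0 ≤ t) (hm : 1 ≤ m) (hmn : m ≤ n) {f : Ω → ℝ}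
    (hf : Measurable[history u ε n] f) (hfi : Integrable f P) :
    ∫ ω, f ω * (descendsEvent u ε t m (n + 1)).indicator (fun _ => (1 : ℝ)) ω ∂P =
      Real.exp (-t) / n * ∫ ω, f ω * size u ε t m n ω ∂P := by
  have hD : ∀ i ∈ Finset.Icc m n, MeasurableSet[history u ε n] (descendsEvent u ε t m i) :=
    fun i hi => history_mono (Finset.mem_Icc.1 hi).2 _ (measurableSet_descendsEvent hm t i)
  have hI : ∀ i ∈ Finset.Icc m n, Integrable (fun ω => f ω *
      (descendsEvent u ε t m i).indicator (fun _ => (1 : ℝ)) ω) P := fun i hi =>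
    integrable_mul_indicator hfi (h.history_le n _ (hD i hi))
  obtain ⟨k, rfl⟩ : ∃ k, n = k + 1 := ⟨n - 1, by omega⟩
  simp_rw [indicator_descendsEvent_succ hmn, size, Finset.mul_sum, ← mul_assoc]
  rw [integral_finsetSum _ hI, integral_finsetSum, Finset.mul_sum]
  · refine Finset.sum_congr rfl fun i hi => ?_
    have hi' := Finset.mem_Icc.1 hi
    exact h.integral_mul_edgeEvent ht (by omega) (Finset.mem_Icc.2 ⟨by omega, hi'.2⟩)
      (hf.mul (Measurable.indicator measurable_const (hD i hi)))
  · intro i hi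
    exact integrable_mul_indicator (hI i hi)
      (h.edgeAlgebra_le k _ (measurableSet_edgeEvent t i k))

/-- The test function `f` replaces conditional expectations: this says E[N(n+1) | first n vertices]
= (1 + a/n) N(n). -/
theorem integral_mul_size_succ (ht : 0 ≤ t) (hm : 1 ≤ m) (hmn : m ≤ n) {f : Ω → ℝ}
    (hf : Measurable[history u ε n] f) (hfi : Integrable f P) :
    ∫ ω, f ω * size u ε t m (n + 1) ω ∂P =
      (1 + Real.exp (-t) / n) * ∫ ω, f ω * size u ε t m n ω ∂P := by
  simp_rw [size_succ hmn, mul_add]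
  rw [integral_add (h.integrable_mul_size hfi hm t n) (integrable_mul_indicator hfi
    (h.history_le _ _ (measurableSet_descendsEvent hm t _))),
    h.integral_mul_descendsEvent_succ ht hm hmn hf hfi]
  ring

/-- N(N + 1) is used instead of N² because its recursion closes: a jump adds (N + 1)(N + 2) - N(N +
1) = 2(N + 1), and has conditional probability aN/n. -/
theorem integral_mul_size_sq_succ (ht : 0 ≤ t) (hm : 1 ≤ m) (hmn : m ≤ n) {f : Ω → ℝ}
    (hf : Measurable[history u ε n] f) (hfi : Integrable f P) :
    ∫ ω, f ω * size u ε t m (n + 1) ω * (size u ε t m (n + 1) ω + 1) ∂P =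
      (1 + 2 * Real.exp (-t) / n) *
        ∫ ω, f ω * size u ε t m n ω * (size u ε t m n ω + 1) ∂P := by
  have hs := measurable_size (u := u) (ε := ε) hm t n
  have hfs := h.integrable_mul_size hfi hm t n
  have hfss := h.integrable_mul_size hfs hm t n
  have hg : Measurable[history u ε n] fun ω => 2 * (f ω * size u ε t m n ω + f ω) :=
    ((hf.mul hs).add hf).const_mul 2
  have hgi : Integrable (fun ω => 2 * (f ω * size u ε t m n ω + f ω)) P :=
    (hfs.add hfi).const_mul 2
  have hq : Integrable (fun ω => f ω * size u ε t m n ω * (size u ε t m n ω + 1)) P := by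
    simp_rw [mul_add, mul_one]
    exact hfss.add hfs
  have hpt : ∀ ω, f ω * size u ε t m (n + 1) ω * (size u ε t m (n + 1) ω + 1) =
      f ω * size u ε t m n ω * (size u ε t m n ω + 1) + 2 * (f ω * size u ε t m n ω + f ω) *
        (descendsEvent u ε t m (n + 1)).indicator (fun _ => (1 : ℝ)) ω := by
    intro ω
    rw [size_succ hmn]
    by_cases hω : ω ∈ descendsEvent u ε t m (n + 1)
    · simp only [hω, Set.indicator_of_mem]; ring
    · simp only [hω, not_false_eq_true, Set.indicator_of_notMem]; ring
  simp_rw [hpt]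
  rw [integral_add hq (integrable_mul_indicator hgi
    (h.history_le _ _ (measurableSet_descendsEvent hm t _))),
    h.integral_mul_descendsEvent_succ ht hm hmn hg hgi]
  have : ∀ ω, 2 * (f ω * size u ε t m n ω + f ω) * size u ε t m n ω =
      2 * (f ω * size u ε t m n ω * (size u ε t m n ω + 1)) := fun ω => by ring
  simp_rw [this]
  rw [integral_const_mul]
  ring

theorem integral_mul_size (ht : 0 ≤ t) (hm : 1 ≤ m) (hmn : m ≤ n) {f : Ω → ℝ}
    (hf : Measurable[history u ε m] f) (hfi : Integrable f P) :
    ∫ ω, f ω * size u ε t m n ω ∂P =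
      growth (Real.exp (-t)) n / growth (Real.exp (-t)) m * ∫ ω, f ω ∂P := by
  have hpos := growth_pos (Real.exp_pos (-t)).le m
  induction n, hmn using Nat.le_induction with
  | base => simp [size_self, div_self hpos.ne']
  | succ n hmn ih =>
    rw [h.integral_mul_size_succ ht hm hmn (hf.mono (history_mono hmn) le_rfl) hfi, ih,
      growth_succ _ (hm.trans hmn)]
    ring

theorem integral_mul_size_sq (ht : 0 ≤ t) (hm : 1 ≤ m) (hmn : m ≤ n) {f : Ω → ℝ}
    (hf : Measurable[history u ε m] f) (hfi : Integrable f P) :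
    ∫ ω, f ω * size u ε t m n ω * (size u ε t m n ω + 1) ∂P =
      2 * growth (2 * Real.exp (-t)) n / growth (2 * Real.exp (-t)) m * ∫ ω, f ω ∂P := by
  have hpos := growth_pos (mul_pos two_pos (Real.exp_pos (-t))).le m
  induction n, hmn using Nat.le_induction with
  | base =>
    simp only [size_self, mul_one]
    rw [integral_mul_const]
    field_simp
    ring
  | succ n hmn ih =>
    rw [h.integral_mul_size_sq_succ ht hm hmn (hf.mono (history_mono hmn) le_rfl) hfi, ih,
      growth_succ _ (hm.trans hmn)]
    ring

end IsDestruction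

end Probability

/-! ### From moment bounds to limiting weights -/

/-- Markov's inequality for the lower limit, whose integral is bounded by Fatou's lemma. The set `s`
need not be measurable. -/
theorem measure_le_of_tendsto_of_integral_le {Ω : Type*} [MeasurableSpace Ω] {P : Measure Ω}
    {f : ℕ → Ω → ℝ} {b : ℕ → ℝ} {L c : ℝ} (hc : 0 < c) (hf : ∀ n, Integrable (f n) P)
    (hfm : ∀ n, Measurable (f n)) (hf0 : ∀ n ω, 0 ≤ f n ω)
    (hb : ∀ᶠ n in atTop, ∫ ω, f n ω ∂P ≤ b n) (hL : Tendsto b atTop (𝓝 L)) {s : Set Ω}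
    (hs : ∀ ω ∈ s, ∃ l, c ≤ l ∧ Tendsto (fun n => f n ω) atTop (𝓝 l)) :
    P s ≤ ENNReal.ofReal (L / c) := by
  have hm : ∀ n, Measurable fun ω => ENNReal.ofReal (f n ω) := fun n => (hfm n).ennreal_ofReal
  have h1 : s ⊆ {ω | ENNReal.ofReal c ≤ liminf (fun n => ENNReal.ofReal (f n ω)) atTop} := by
    intro ω hω
    obtain ⟨l, hl, ht⟩ := hs ω hω
    have := ((ENNReal.continuous_ofReal.tendsto l).comp ht).liminf_eq
    simp only [Function.comp_def] at this
    rw [Set.mem_ofPred_eq, this]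
    exact ENNReal.ofReal_le_ofReal hl
  have h2 : ∫⁻ ω, liminf (fun n => ENNReal.ofReal (f n ω)) atTop ∂P ≤ ENNReal.ofReal L := by
    refine (lintegral_liminf_le hm).trans ?_
    rw [← ((ENNReal.continuous_ofReal.tendsto L).comp hL).liminf_eq]
    refine liminf_le_liminf ?_
    filter_upwards [hb] with n hn
    rw [← ofReal_integral_eq_lintegral_ofReal (hf n) (ae_of_all _ (hf0 n))]
    exact ENNReal.ofReal_le_ofReal hn
  rw [ENNReal.ofReal_div_of_pos hc,
    ENNReal.le_div_iff_mul_le (Or.inl (ENNReal.ofReal_pos.2 hc).ne') (Or.inl ENNReal.ofReal_ne_top),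
    mul_comm]
  calc _ ≤ ENNReal.ofReal c *
        P {ω | ENNReal.ofReal c ≤ liminf (fun n => ENNReal.ofReal (f n ω)) atTop} := by gcongr
    _ ≤ _ := mul_meas_ge_le_lintegral₀ (Measurable.liminf hm).aemeasurable _
    _ ≤ _ := h2

theorem tendsto_rpow_neg_mul_growth {a : ℝ} (ha : 0 < a) :
    Tendsto (fun n : ℕ => (n : ℝ) ^ (-a) * growth a n) atTop (𝓝 (1 / Real.Gamma (1 + a))) := by
  refine (tendsto_growth_div_rpow ha).congr fun n => ?_
  rw [Real.rpow_neg (Nat.cast_nonneg n), div_eq_inv_mul]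

theorem tendsto_rpow_neg_sq_mul_growth {a : ℝ} (ha : 0 < a) :
    Tendsto (fun n : ℕ => ((n : ℝ) ^ (-a)) ^ 2 * growth (2 * a) n) atTop
      (𝓝 (1 / Real.Gamma (1 + 2 * a))) := by
  refine (tendsto_rpow_neg_mul_growth (mul_pos two_pos ha)).congr fun n => ?_
  rw [← Real.rpow_mul_natCast (Nat.cast_nonneg n)]
  congr 2
  push_cast
  ring

/-! ### Existence of the weights and tail estimates -/

namespace IsDestruction

variable {Ω : Type*} [MeasurableSpace Ω] {P : Measure Ω} {u : ℕ → Ω → ℕ} {ε : ℕ → Ω → ℝ}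
  (h : IsDestruction P u ε) {t : ℝ} {m n i : ℕ}
include h

/-- The history of the vertices, starting from the vertex `m`. -/
def historyFiltration (m : ℕ) : Filtration ℕ ‹MeasurableSpace Ω› where
  seq k := history u ε (m + k)
  mono' _ _ hkl := history_mono (Nat.add_le_add_left hkl m)
  le' k := h.history_le (m + k)

theorem measurable_size' (hm : 1 ≤ m) (t : ℝ) (n : ℕ) : Measurable (size u ε t m n) :=
  (measurable_size hm t n).mono (h.history_le n) le_rfl

variable [IsProbabilityMeasure P]

theorem integrable_size (hm : 1 ≤ m) (t : ℝ) (n : ℕ) : Integrable (size u ε t m n) P := by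
  simpa using h.integrable_mul_size (integrable_const (1 : ℝ)) hm t n

theorem martingale_size (ht : 0 ≤ t) (hm : 1 ≤ m) :
    Martingale (fun k ω => size u ε t m (m + k) ω / growth (Real.exp (-t)) (m + k))
      (h.historyFiltration m) P := by
  refine martingale_of_setIntegral_eq_succ (fun k => ?_) (fun k => ?_) fun k s hs => ?_
  · exact ((measurable_size hm t (m + k)).div_const _).stronglyMeasurable
  · exact (h.integrable_size hm t (m + k)).div_const _
  · have hs' := h.history_le _ _ hs
    have hk : (0 : ℝ) < (m + k : ℕ) := by exact_mod_cast (by omega : 0 < m + k)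
    -- Testing against the indicator of `s` turns the recursion into the martingale identity for
    -- integrals over `s`.
    have hrec := h.integral_mul_size_succ (n := m + k) ht hm (by omega)
      (f := s.indicator fun _ => 1) (Measurable.indicator measurable_const hs)
      ((integrable_const 1).indicator hs')
    have hset : ∀ n, ∫ ω, s.indicator (fun _ => (1 : ℝ)) ω * size u ε t m n ω ∂P =
        ∫ ω in s, size u ε t m n ω ∂P := by
      intro n
      rw [← integral_indicator hs']
      refine integral_congr_ae (ae_of_all _ fun ω => ?_)
      by_cases hω : ω ∈ s <;> simp [hω]
    rw [hset, hset] at hrec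
    rw [integral_div, integral_div, ← add_assoc, hrec, growth_succ _ (by omega)]
    have h1 := growth_pos (Real.exp_pos (-t)).le (m + k)
    have h2 : 0 < 1 + Real.exp (-t) / (m + k : ℕ) := by positivity
    rw [mul_comm, mul_div_mul_right _ _ h2.ne']

theorem ae_exists_tendsto_scaledCount (ht : 0 ≤ t) (hm : 1 ≤ m) : ∀ᵐ ω ∂P, ∃ c, Tendsto
    (scaledCount t {j | Descends (fun k => u k ω) (fun k => ε k ω) t m j}) atTop (𝓝 c) := by
  have hpos := growth_pos (Real.exp_pos (-t)).le
  have hb : ∀ k, eLpNorm (fun ω => size u ε t m (m + k) ω / growth (Real.exp (-t)) (m + k)) 1 P ≤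
      ENNReal.ofReal (1 / growth (Real.exp (-t)) m) := by
    intro k
    have h0 : ∀ ω, 0 ≤ size u ε t m (m + k) ω / growth (Real.exp (-t)) (m + k) :=
      fun ω => div_nonneg (size_nonneg ω) (hpos _).le
    rw [eLpNorm_one_eq_lintegral_enorm]
    simp_rw [Real.enorm_of_nonneg (h0 _)]
    rw [← ofReal_integral_eq_lintegral_ofReal ((h.integrable_size hm t (m + k)).div_const _)
      (ae_of_all _ h0)]
    refine ENNReal.ofReal_le_ofReal (le_of_eq ?_)
    have := h.integral_mul_size (n := m + k) ht hm (by omega) (f := fun _ => 1) measurable_const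
      (integrable_const 1)
    simp only [one_mul, integral_const, probReal_univ, smul_eq_mul] at this
    rw [integral_div, this, mul_one, div_div_cancel_left' (hpos _).ne', one_div]
  filter_upwards [(h.martingale_size ht hm).submartingale.exists_ae_tendsto_of_bdd hb] with ω hω
  obtain ⟨c, hc⟩ := hω
  have hc' : Tendsto (fun n => size u ε t m n ω / growth (Real.exp (-t)) n) atTop (𝓝 c) := by
    rw [← tendsto_add_atTop_iff_nat m]
    simpa only [add_comm m] using hc
  refine ⟨_, ((tendsto_rpow_neg_mul_growth (Real.exp_pos (-t))).mul hc').congr fun n => ?_⟩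
  rw [scaledCount_descends, mul_assoc, mul_div_cancel₀ _ (hpos n).ne']

/-- The cluster of the vertex `1` has a limiting weight close to `1`. -/
theorem measure_root_weight_le (ht : 0 ≤ t) :
    P {ω | ∃ l ≤ 1 / 2, Tendsto (scaledCount t
      {j | Descends (fun k => u k ω) (fun k => ε k ω) t 1 j}) atTop (𝓝 l)} ≤
    ENNReal.ofReal (4 * (2 / Real.Gamma (1 + 2 * Real.exp (-t)) -
      2 / Real.Gamma (1 + Real.exp (-t)) + 1)) := by
  set a := Real.exp (-t) with ha
  have ha0 : 0 < a := Real.exp_pos _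
  have hL : Tendsto (fun n : ℕ => 2 * (((n : ℝ) ^ (-a)) ^ 2 * growth (2 * a) n) -
      2 * ((n : ℝ) ^ (-a) * growth a n) + 1) atTop
      (𝓝 (2 * (1 / Real.Gamma (1 + 2 * a)) - 2 * (1 / Real.Gamma (1 + a)) + 1)) :=
    (((tendsto_rpow_neg_sq_mul_growth ha0).const_mul 2).sub
      ((tendsto_rpow_neg_mul_growth ha0).const_mul 2)).add_const 1
  have hN : ∀ n, Integrable (size u ε t 1 n) P := h.integrable_size le_rfl t
  have hNN : ∀ n, Integrable (fun ω => size u ε t 1 n ω * size u ε t 1 n ω) P :=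
    fun n => h.integrable_mul_size (hN n) le_rfl t n
  have hexp : ∀ (n : ℕ) ω, ((n : ℝ) ^ (-a) * size u ε t 1 n ω - 1) ^ 2 =
      ((n : ℝ) ^ (-a)) ^ 2 * (size u ε t 1 n ω * size u ε t 1 n ω) -
        2 * (n : ℝ) ^ (-a) * size u ε t 1 n ω + 1 := fun n ω => by ring
  have hi1 : ∀ n : ℕ, Integrable (fun ω =>
      ((n : ℝ) ^ (-a)) ^ 2 * (size u ε t 1 n ω * size u ε t 1 n ω) -
        2 * (n : ℝ) ^ (-a) * size u ε t 1 n ω) P :=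
    fun n => ((hNN n).const_mul _).sub ((hN n).const_mul _)
  -- A limit `l ≤ 1 / 2` has (l - 1)² ≥ 1/4.
  refine (measure_le_of_tendsto_of_integral_le (c := 1 / 4)
    (f := fun n ω => ((n : ℝ) ^ (-a) * size u ε t 1 n ω - 1) ^ 2)
    (by norm_num) (fun n => ?_) (fun n => ?_) (fun n ω => sq_nonneg _) ?_ hL ?_).trans
      (le_of_eq (by congr 1; ring))
  · simp_rw [hexp]
    exact (hi1 n).add (integrable_const 1)
  · exact (((h.measurable_size' le_rfl t n).const_mul _).sub_const 1).pow_const 2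
  · filter_upwards [eventually_ge_atTop 1] with n hn
    have h1 := h.integral_mul_size ht le_rfl hn (f := fun _ => 1) measurable_const
      (integrable_const 1)
    have h2 := h.integral_mul_size_sq ht le_rfl hn (f := fun _ => 1) measurable_const
      (integrable_const 1)
    simp only [one_mul, integral_const, probReal_univ, smul_eq_mul, growth_one, div_one, mul_one,
      ← ha] at h1 h2
    -- N² ≤ N(N + 1) loses only a term of order N, negligible after scaling.
    have h3 : ∫ ω, size u ε t 1 n ω * size u ε t 1 n ω ∂P ≤ 2 * growth (2 * a) n := by
      rw [← h2]
      refine integral_mono (hNN n) ?_ fun ω => ?_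
      · simp_rw [mul_add, mul_one]
        exact (hNN n).add (hN n)
      · have := size_nonneg (u := u) (ε := ε) (t := t) (m := 1) (n := n) ω
        simp only [mul_add, mul_one]
        linarith
    simp_rw [hexp]
    rw [integral_add (hi1 n) (integrable_const 1), integral_sub ((hNN n).const_mul _)
      ((hN n).const_mul _), integral_const_mul, integral_const_mul, h1]
    simp only [integral_const, probReal_univ, smul_eq_mul, mul_one]
    have := mul_le_mul_of_nonneg_left h3 (sq_nonneg ((n : ℝ) ^ (-a)))
    linarith
  · rintro ω ⟨l, hl, hlim⟩
    refine ⟨(l - 1) ^ 2, by nlinarith, ((hlim.sub_const 1).pow 2).congr fun n => ?_⟩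
    rw [scaledCount_descends]

/-- It is unlikely that the edge above a vertex `m` is removed by time `t` and that the
descendants of `m` have a large limiting weight. -/
theorem measure_detached_weight_le (ht : 0 ≤ t) (hm : 2 ≤ m) :
    P {ω | ε m ω ≤ t ∧ ∃ l ≥ 1 / 2, Tendsto (scaledCount t
      {j | Descends (fun k => u k ω) (fun k => ε k ω) t m j}) atTop (𝓝 l)} ≤
    ENNReal.ofReal (8 * (1 - Real.exp (-t)) / Real.Gamma (1 + 2 * Real.exp (-t)) *
      (growth (2 * Real.exp (-t)) m)⁻¹) := by
  set a := Real.exp (-t) with ha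
  have ha0 : 0 < a := Real.exp_pos _
  have hm1 : 1 ≤ m := by omega
  -- The cut above `m` is known from the first `m` vertices, so it may serve as test function; its
  -- mean supplies the small factor 1 - a.
  set g : Ω → ℝ := {ω | ε m ω ≤ t}.indicator fun _ => 1 with hg
  have hg0 : ∀ ω, 0 ≤ g ω := fun ω => Set.indicator_nonneg (fun _ _ => zero_le_one) ω
  have hset : MeasurableSet[history u ε m] {ω | ε m ω ≤ t} := by
    obtain ⟨k, rfl⟩ : ∃ k, m = k + 2 := ⟨m - 2, by omega⟩
    exact edgeAlgebra_le_history le_rfl _ (measurable_time_edgeAlgebra k measurableSet_Iic)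
  have hgm : Measurable[history u ε m] g := Measurable.indicator measurable_const hset
  have hgi : Integrable g P := (integrable_const 1).indicator (h.history_le m _ hset)
  have hgint : ∫ ω, g ω ∂P = 1 - a := by
    rw [ha, ← h.measureReal_time_le ht hm]
    exact integral_indicator_one (h.history_le m _ hset)
  have hgN : ∀ n, Integrable (fun ω => g ω * size u ε t m n ω) P :=
    fun n => h.integrable_mul_size hgi hm1 t n
  have hgNN : ∀ n, Integrable (fun ω => g ω * size u ε t m n ω * size u ε t m n ω) P :=
    fun n => h.integrable_mul_size (hgN n) hm1 t n
  have hL := (tendsto_rpow_neg_sq_mul_growth ha0).const_mul (2 / growth (2 * a) m * (1 - a))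
  have hexp : ∀ (n : ℕ) ω, g ω * ((n : ℝ) ^ (-a) * size u ε t m n ω) ^ 2 =
      ((n : ℝ) ^ (-a)) ^ 2 * (g ω * size u ε t m n ω * size u ε t m n ω) := fun n ω => by ring
  refine (measure_le_of_tendsto_of_integral_le (c := 1 / 4)
    (f := fun n ω => g ω * ((n : ℝ) ^ (-a) * size u ε t m n ω) ^ 2)
    (by norm_num) (fun n => ?_) (fun n => ?_) (fun n ω => mul_nonneg (hg0 ω) (sq_nonneg _)) ?_ hL
      ?_).trans (le_of_eq (by congr 1; field_simp; ring))
  · simp_rw [hexp]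
    exact (hgNN n).const_mul _
  · exact (hgm.mono (h.history_le m) le_rfl).mul
      (((h.measurable_size' hm1 t n).const_mul _).pow_const 2)
  · filter_upwards [eventually_ge_atTop m] with n hn
    have h2 := h.integral_mul_size_sq ht hm1 hn hgm hgi
    rw [hgint, ← ha] at h2
    have h3 : ∫ ω, g ω * size u ε t m n ω * size u ε t m n ω ∂P ≤
        2 * growth (2 * a) n / growth (2 * a) m * (1 - a) := by
      rw [← h2]
      refine integral_mono (hgNN n) ?_ fun ω => ?_
      · simp_rw [mul_add, mul_one]
        exact (hgNN n).add (hgN n)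
      · have := mul_nonneg (hg0 ω) (size_nonneg (u := u) (ε := ε) (t := t) (m := m) (n := n) ω)
        simp only [mul_add, mul_one]
        linarith
    simp_rw [hexp]
    rw [integral_const_mul]
    refine (mul_le_mul_of_nonneg_left h3 (sq_nonneg ((n : ℝ) ^ (-a)))).trans (le_of_eq ?_)
    ring
  · rintro ω ⟨hω, l, hl, hlim⟩
    have hg1 : g ω = 1 := Set.indicator_of_mem (s := {ω | ε m ω ≤ t}) hω _
    refine ⟨l ^ 2, by nlinarith, (hlim.pow 2).congr fun n => ?_⟩
    rw [scaledCount_descends, hg1, one_mul]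

theorem ae_tendsto_X (ht : 0 ≤ t) : ∀ᵐ ω ∂P, ∀ i,
    Tendsto (scaledCount t (partBlock u ε i t ω)) atTop (𝓝 (X u ε i t ω)) := by
  have hall : ∀ᵐ ω ∂P, ∀ m, 1 ≤ m → ∃ c, Tendsto
      (scaledCount t {j | Descends (fun k => u k ω) (fun k => ε k ω) t m j}) atTop (𝓝 c) :=
    ae_all_iff.2 fun m => by
      by_cases hm : 1 ≤ m
      · filter_upwards [h.ae_exists_tendsto_scaledCount ht hm] with ω hω _ using hω
      · exact ae_of_all _ fun ω h' => absurd h' hm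
  filter_upwards [h.ae_parent, hall] with ω hp hω i
  refine tendsto_nhds_limUnder ?_
  rcases block_eq_empty_or (e := fun k => ε k ω) (t := t) hp i with hb | ⟨m, hm, -, hb⟩
  · rw [partBlock, hb, scaledCount_empty]
    exact ⟨0, tendsto_const_nhds⟩
  · rw [partBlock, hb]
    exact hω m hm.1

/-- The probability that the cluster of the root fails to have the largest weight. -/
theorem measure_not_root_largest_le (ht : 0 ≤ t) (ht' : 3 / 2 ≤ 2 * Real.exp (-t)) :
    P {ω | ∀ i, 2 ≤ i → X u ε i t ω < X u ε 1 t ω}ᶜ ≤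
    ENNReal.ofReal (4 * (2 / Real.Gamma (1 + 2 * Real.exp (-t)) -
      2 / Real.Gamma (1 + Real.exp (-t)) + 1)) +
    ENNReal.ofReal (8 * (1 - Real.exp (-t)) / Real.Gamma (1 + 2 * Real.exp (-t)) *
      ∑' m, (growth (3 / 2) m)⁻¹) := by
  set A : Set Ω := {ω | ∃ l ≤ 1 / 2, Tendsto (scaledCount t
      {j | Descends (fun k => u k ω) (fun k => ε k ω) t 1 j}) atTop (𝓝 l)}
  set B : ℕ → Set Ω := fun m => {ω | 2 ≤ m ∧ ε m ω ≤ t ∧ ∃ l ≥ 1 / 2, Tendsto (scaledCount t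
      {j | Descends (fun k => u k ω) (fun k => ε k ω) t m j}) atTop (𝓝 l)}
  have hsub : ({ω | ∀ i, 2 ≤ i → X u ε i t ω < X u ε 1 t ω}ᶜ : Set Ω) ≤ᵐ[P]
      (A ∪ ⋃ m, B m : Set Ω) := by
    filter_upwards [h.ae_parent, h.ae_tendsto_X ht] with ω hp hX hω
    have hω' : ¬ ∀ i, 2 ≤ i → X u ε i t ω < X u ε 1 t ω := hω
    push Not at hω'
    obtain ⟨i, hi, hle⟩ := hω'
    have h1 := hX 1
    have h2 := hX i
    rw [partBlock, block_one hp] at h1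
    -- If the root fails to be largest, either its weight is at most 1/2 or some other block has
    -- weight above 1/2. In the latter case the block is nonempty, with a cut vertex as its root.
    rcases le_or_gt (X u ε 1 t ω) (1 / 2) with hl | hl
    · exact Or.inl ⟨_, hl, h1⟩
    · rcases block_eq_empty_or (e := fun k => ε k ω) (t := t) hp i with hb | ⟨m, hm, hm2, hb⟩
      · rw [partBlock, hb, scaledCount_empty] at h2
        have := tendsto_nhds_unique h2 tendsto_const_nhds
        linarith
      · rw [partBlock, hb] at h2
        have hm2 := hm2 hi
        refine Or.inr (Set.mem_iUnion.2 ⟨m, hm2, hm.2.resolve_left (by omega), _, ?_, h2⟩)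
        linarith
  have ha1 : 0 ≤ 1 - Real.exp (-t) := by
    have := Real.exp_le_one_iff.2 (neg_nonpos.2 ht)
    linarith
  have hG : 0 < Real.Gamma (1 + 2 * Real.exp (-t)) :=
    Real.Gamma_pos_of_pos (by have := Real.exp_pos (-t); linarith)
  -- Replacing 2a by 3/2 makes the series independent of t, so that only the prefactor varies as t →
  -- 0.
  have hB : ∀ m, P (B m) ≤ ENNReal.ofReal
      (8 * (1 - Real.exp (-t)) / Real.Gamma (1 + 2 * Real.exp (-t)) * (growth (3 / 2) m)⁻¹) := by
    intro m
    by_cases hm : 2 ≤ m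
    · refine (measure_mono fun ω hω => hω.2).trans ((h.measure_detached_weight_le ht hm).trans ?_)
      refine ENNReal.ofReal_le_ofReal (mul_le_mul_of_nonneg_left ?_ (by positivity))
      exact inv_anti₀ (growth_pos (by norm_num) m) (growth_le_growth (by norm_num) ht' m)
    · have : B m = ∅ := Set.eq_empty_of_forall_notMem fun ω hω => hm hω.1
      simp [this]
  refine (measure_mono_ae hsub).trans ((measure_union_le _ _).trans
    (add_le_add (h.measure_root_weight_le ht) ?_))
  refine (measure_iUnion_le B).trans ((ENNReal.tsum_le_tsum hB).trans (le_of_eq ?_))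
  rw [← tsum_mul_left, ENNReal.ofReal_tsum_of_nonneg]
  · exact fun m => mul_nonneg (by positivity) (inv_nonneg.2 (growth_pos (by norm_num) m).le)
  · exact (summable_inv_growth (by norm_num)).mul_left _

end IsDestruction

end RecursiveTree

/-! ### The limit of small times -/

theorem corollary4 {Ω : Type*} [MeasurableSpace Ω] (P : Measure Ω) [IsProbabilityMeasure P]
    (u : ℕ → Ω → ℕ) (ε : ℕ → Ω → ℝ) (h : RecursiveTree.IsDestruction P u ε) :
    (∀ t : ℝ, 0 < t → ∀ᵐ ω ∂P, ∀ i : ℕ, 1 ≤ i →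
      Tendsto (RecursiveTree.scaledCount t (RecursiveTree.partBlock u ε i t ω)) atTop
        (𝓝 (RecursiveTree.X u ε i t ω))) ∧
    Tendsto
      (fun t : ℝ => P {ω | ∀ i : ℕ, 2 ≤ i → RecursiveTree.X u ε i t ω < RecursiveTree.X u ε 1 t ω})
      (𝓝[>] 0) (𝓝 1) := by
  refine ⟨fun t ht => ?_, ?_⟩
  · filter_upwards [h.ae_tendsto_X ht.le] with ω hω i _ using hω i
  have hexp : Tendsto (fun t : ℝ => Real.exp (-t)) (𝓝[>] 0) (𝓝 1) := by
    have : Tendsto (fun t : ℝ => Real.exp (-t)) (𝓝 0) (𝓝 (Real.exp (-0))) :=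
      (Real.continuous_exp.comp continuous_neg).tendsto 0
    rw [neg_zero, Real.exp_zero] at this
    exact this.mono_left nhdsWithin_le_nhds
  have hG : ∀ x : ℝ, 0 < x → ContinuousAt Real.Gamma x := fun x hx =>
    (Real.differentiableAt_Gamma fun k => by
      have : (0 : ℝ) ≤ k := k.cast_nonneg
      linarith).continuousAt
  have hG1 : Tendsto (fun t : ℝ => Real.Gamma (1 + Real.exp (-t))) (𝓝[>] 0) (𝓝 1) := by
    have := (hG (1 + 1) (by norm_num)).tendsto.comp (hexp.const_add 1)
    rwa [one_add_one_eq_two, Real.Gamma_two] at this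
  have hG2 : Tendsto (fun t : ℝ => Real.Gamma (1 + 2 * Real.exp (-t))) (𝓝[>] 0) (𝓝 2) := by
    have := (hG (1 + 2 * 1) (by norm_num)).tendsto.comp ((hexp.const_mul 2).const_add 1)
    rwa [show (1 + 2 * 1 : ℝ) = 2 + 1 by norm_num, Real.Gamma_add_one two_ne_zero, Real.Gamma_two,
      mul_one] at this
  have hb1 := (((tendsto_const_nhds (x := (2 : ℝ))).div hG2 two_ne_zero).sub
    ((tendsto_const_nhds (x := (2 : ℝ))).div hG1 one_ne_zero)).add_const 1 |>.const_mul 4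
  have hb2 := (((hexp.const_sub 1).const_mul 8).div hG2 two_ne_zero).mul_const
    (∑' m, (RecursiveTree.growth (3 / 2) m)⁻¹)
  have hlow := ENNReal.Tendsto.sub (tendsto_const_nhds (x := (1 : ENNReal)))
    ((ENNReal.tendsto_ofReal hb1).add (ENNReal.tendsto_ofReal hb2)) (Or.inl ENNReal.one_ne_top)
  -- Both error terms vanish because Γ(2) = 1, Γ(3) = 2 and a → 1.
  have hzero : (1 : ENNReal) - (ENNReal.ofReal (4 * (2 / 2 - 2 / 1 + 1)) +
      ENNReal.ofReal (8 * (1 - 1) / 2 * ∑' m, (RecursiveTree.growth (3 / 2) m)⁻¹)) = 1 := by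
    norm_num
  rw [hzero] at hlow
  refine tendsto_of_tendsto_of_tendsto_of_le_of_le' hlow tendsto_const_nhds ?_
    (Eventually.of_forall fun t => prob_le_one)
  filter_upwards [self_mem_nhdsWithin, hexp.eventually (eventually_ge_nhds (by norm_num :
    (3 / 4 : ℝ) < 1))] with t ht ht'
  have ha : 3 / 2 ≤ 2 * Real.exp (-t) := by linarith
  -- Subadditivity on the event and its complement suffices, so the event need not be shown
  -- measurable.
  refine tsub_le_iff_right.2 ?_
  refine le_trans ?_ (add_le_add le_rfl
    (h.measure_not_root_largest_le (le_of_lt ht) ha))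
  rw [← measure_univ (μ := P), ← Set.union_compl_self
    {ω | ∀ i : ℕ, 2 ≤ i → RecursiveTree.X u ε i t ω < RecursiveTree.X u ε 1 t ω}]
  exact measure_union_le _ _
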